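/- Let $\mathbb R^{d_x}$, $\mathbb R^{d_y}$ and $\mathbb R^{d_x}\times\mathbb R^{d_y}$ carry their Euclidean norms, and matrices the operator norm. Let $f,g:\mathbb R^{d_x}\times\mathbb R^{d_y}\to\mathbb R$ be twice continuously differentiable and let $\mu>0$ be such that $g(x,\cdot)$ is $\mu$-strongly convex for every $x$. Suppose that $f$ is $L_{f,0}$-Lipschitz, $\nabla f$ is $L_{f,1}$-Lipschitz, $\nabla g$ is $L_{g,1}$-Lipschitz, and $\nabla_x\nabla_y g$ (the $d_x\times d_y$ matrix with entries $\partial^2 g/\partial x_i\partial y_j$) and $\nabla_y\nabla_y g$ are $L_{g,2}$-Lipschitz, all jointly in $(x,y)$. Let $C_{f_y}$, $C_{g_{xy}}$ be constants with $\|\nabla_y f(x,y)\|\le C_{f_y}$ and $\|\nabla_x\nabla_y g(x,y)\|\le C_{g_{xy}}$ for all $(x,y)$ (such constants exist by the Lipschitz assumptions). Put $y^*(x)=\arg\min_y g(x,y)$, $\Phi(x)=f(x,y^*(x))$, and assume $\inf\Phi>-\infty$. Write $$R(x,y,v)=\tfrac12 v^T\nabla_y\nabla_y g(x,y)v-v^T\nabla_y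 f(x,y),\qquad \bar\nabla f(x,y,v)=\nabla_x f(x,y)-\nabla_x\nabla_y g(x,y)\,v .$$ Algorithm (D-TFBO). Input: $x_0$, $y_0$, $v_0$, $\alpha_0,\beta_0,\gamma_0>0$, an integer $T\ge1$, and $\epsilon_y=\epsilon_v=1/T$. For $t=0,\dots,T-1$: 1. Start from $y_t^0=y_{t-1}^{P_{t-1}}$ and $v_t^0=v_{t-1}^{Q_{t-1}}$ if $t>0$, and from $y_0^0=y_0$, $v_0^0=v_0$ if $t=0$. Both step-size accumulators below are reset to $\beta_0$ and $\gamma_0$ at each $t$. 2. For $p=0,1,\dots$, while $\|\nabla_y g(x_t,y_t^p)\|^2>\epsilon_y$, set $\beta_{p+1}^2=\beta_p^2+\|\nabla_y g(x_t,y_t^p)\|^2$ and $y_t^{p+1}=y_t^p-\frac1{\beta_{p+1}}\nabla_y g(x_t,y_t^p)$. Let $P_t$ be the first $p$ at which the loop condition fails. 3. For $q=0,1,\dots$, while $\|\nabla_v R(x_t,y_t^{P_t},v_t^q)\|^2>\epsilon_v$, set $\gamma_{q+1}^2=\gamma_q^2+\|\nabla_v R(x_t,y_t^{P_t},v_t^q)\|^2$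 and $v_t^{q+1}=v_t^q-\frac1{\gamma_{q+1}}\nabla_v R(x_t,y_t^{P_t},v_t^q)$. Let $Q_t$ be the first $q$ at which the loop condition fails. 4. Set $\alpha_{t+1}^2=\alpha_t^2+\|\bar\nabla f(x_t,y_t^{P_t},v_t^{Q_t})\|^2$ and $x_{t+1}=x_t-\frac1{\alpha_{t+1}}\bar\nabla f(x_t,y_t^{P_t},v_t^{Q_t})$. Here $\beta_p,\gamma_q,\alpha_t$ denote positive square roots. Define the constants, none of which depends on $T$, $$L_\Phi=\Big(L_{f,1}+\tfrac{L_{g,2}C_{f_y}}{\mu}\Big)\Big(1+\tfrac{C_{g_{xy}}}{\mu}\Big)^2,\qquad C_\alpha=\max\{2L_\Phi,\alpha_0\},\qquad \bar L_v=\tfrac{L_{f,1}}{\mu}+\tfrac{C_{f_y}L_{g,2}}{\mu^2},$$ $$\bar L=\max\Big\{2\Big(\tfrac{C_{f_y}^2L_{g,2}^2}{\mu^2}+L_{f,1}^2+C_{g_{xy}}^2\bar L_v^2\Big)^{1/2},\ 2C_{g_{xy}}\Big\},\qquad c_0=2\big(\Phi(x_0)-\inf\Phi\big)+\tfrac{L_\Phi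 C_\alpha^2}{2\alpha_0^2},$$ $$c_1=c_0+\tfrac1{\alpha_0}\Big[\Big(\tfrac{2}{\mu^2}\big(\tfrac{L_{g,2}C_{f_y}}{\mu}+L_{f,1}\big)+1\Big)L_{g,1}^2\bar L^2+\tfrac{2\bar L^2}{\mu^2}\Big].$$ Theorem. $\Phi$ is differentiable; for every $T\ge1$ all sub-loops terminate (so that $P_t$, $Q_t$ and the iterates exist for all $t<T$), and $$\frac1T\sum_{t=0}^{T-1}\|\nabla\Phi(x_t)\|^2\le\frac{c_1(C_\alpha+2c_1)}{T}.$$ In particular, for fixed $f,g$ and fixed $x_0,y_0,v_0,\alpha_0,\beta_0,\gamma_0$, the left-hand side is $\mathcal O(1/T)$ as $T\to\infty$. -/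

import Mathlib

open scoped NNReal Gradient InnerProductSpace

noncomputable section

namespace Bilevel

/-- `ℝ^n` with its Euclidean norm. -/
abbrev Vec (n : ℕ) : Type := EuclideanSpace ℝ (Fin n)

/-- `ℝ^dx × ℝ^dy` with the Euclidean norm `‖(x, y)‖² = ‖x‖² + ‖y‖²`. -/
abbrev Pair (dx dy : ℕ) : Type := WithLp 2 (Vec dx × Vec dy)

/-- The point `(x, y)`. -/
abbrev pair {dx dy : ℕ} (x : Vec dx) (y : Vec dy) : Pair dx dy := WithLp.toLp 2 (x, y)

/-- `∇_x h(x, y)`. -/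
def gradX {dx dy : ℕ} (h : Pair dx dy → ℝ) (x : Vec dx) (y : Vec dy) : Vec dx :=
  gradient (fun x' => h (pair x' y)) x

/-- `∇_y h(x, y)`. -/
def gradY {dx dy : ℕ} (h : Pair dx dy → ℝ) (x : Vec dx) (y : Vec dy) : Vec dy :=
  gradient (fun y' => h (pair x y')) y

/-- `∇_y ∇_y h(x, y)`, the `dy × dy` Hessian in `y`, as an operator. -/
def hessYY {dx dy : ℕ} (h : Pair dx dy → ℝ) (x : Vec dx) (y : Vec dy) : Vec dy →L[ℝ] Vec dy :=
  fderiv ℝ (fun y' => gradY h x y') y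

/-- `∇_x ∇_y h(x, y)`, the `dx × dy` matrix with entries `∂²h / ∂x_i ∂y_j`, as an operator
from `ℝ^dy` to `ℝ^dx`: the transpose of the Jacobian of `x ↦ ∇_y h(x, y)`. -/
def hessXY {dx dy : ℕ} (h : Pair dx dy → ℝ) (x : Vec dx) (y : Vec dy) : Vec dy →L[ℝ] Vec dx :=
  ContinuousLinearMap.adjoint (fderiv ℝ (fun x' => gradY h x' y) x)

/-- `y*(x)`, a minimizer of `g(x, ·)` (it exists and is unique when `g(x, ·)` is continuous and
strongly convex). -/
def lowerSol {dx dy : ℕ} (g : Pair dx dy → ℝ) (x : Vec dx) : Vec dy :=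
  Classical.epsilon fun y => ∀ y', g (pair x y) ≤ g (pair x y')

/-- The outer objective `Φ(x) = f(x, y*(x))`. -/
def Phi {dx dy : ℕ} (f g : Pair dx dy → ℝ) (x : Vec dx) : ℝ :=
  f (pair x (lowerSol g x))

/-- `R(x, y, v) = ½ vᵀ ∇_y∇_y g(x, y) v - vᵀ ∇_y f(x, y)`. -/
def linSys {dx dy : ℕ} (f g : Pair dx dy → ℝ) (x : Vec dx) (y v : Vec dy) : ℝ :=
  1 / 2 * ⟪v, hessYY g x y v⟫_ℝ - ⟪v, gradY f x y⟫_ℝ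

/-- `∇_v R(x, y, v)`. -/
def gradLinSys {dx dy : ℕ} (f g : Pair dx dy → ℝ) (x : Vec dx) (y v : Vec dy) : Vec dy :=
  gradient (fun v' => linSys f g x y v') v

/-- The hypergradient estimate `∇_x f(x, y) - ∇_x∇_y g(x, y) v`. -/
def hyperGrad {dx dy : ℕ} (f g : Pair dx dy → ℝ) (x : Vec dx) (y v : Vec dy) : Vec dx :=
  gradX f x y - hessXY g x y v

/-! ### The algorithm -/

/-- The iterates `(z_p, b_p)` of a sub-loop with direction field `G`, regardless of stopping:
`b_{p+1}² = b_p² + ‖G z_p‖²`, `z_{p+1} = z_p - (1 / b_{p+1}) G z_p`. -/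
def subLoop {n : ℕ} (G : Vec n → Vec n) (z₀ : Vec n) (b₀ : ℝ) : ℕ → Vec n × ℝ
  | 0 => (z₀, b₀)
  | p + 1 =>
    let s := subLoop G z₀ b₀ p
    let b := √(s.2 ^ 2 + ‖G s.1‖ ^ 2)
    (s.1 - (1 / b) • G s.1, b)

/-- The while loop `while ‖G z_p‖² > ε` terminates. -/
def SubLoopStops {n : ℕ} (G : Vec n → Vec n) (z₀ : Vec n) (b₀ ε : ℝ) : Prop :=
  ∃ p, ‖G (subLoop G z₀ b₀ p).1‖ ^ 2 ≤ ε

/-- The number of passes through the while loop: the first `p` with `‖G z_p‖² ≤ ε`. -/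
def subLoopSteps {n : ℕ} (G : Vec n → Vec n) (z₀ : Vec n) (b₀ ε : ℝ) : ℕ :=
  sInf {p | ‖G (subLoop G z₀ b₀ p).1‖ ^ 2 ≤ ε}

/-- The value with which the while loop is left. -/
def subLoopOut {n : ℕ} (G : Vec n → Vec n) (z₀ : Vec n) (b₀ ε : ℝ) : Vec n :=
  (subLoop G z₀ b₀ (subLoopSteps G z₀ b₀ ε)).1

/-- The variables at the start of outer iteration `t`: `x_t`, `α_t` and the warm starts
`y_t^0`, `v_t^0`. -/
structure State (dx dy : ℕ) where
  x : Vec dx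
  y : Vec dy
  v : Vec dy
  α : ℝ

/-- The result `y_t^{P_t}` of the first sub-loop. -/
def innerY {dx dy : ℕ} (g : Pair dx dy → ℝ) (β₀ εy : ℝ) (s : State dx dy) : Vec dy :=
  subLoopOut (gradY g s.x) s.y β₀ εy

/-- The result `v_t^{Q_t}` of the second sub-loop. -/
def innerV {dx dy : ℕ} (f g : Pair dx dy → ℝ) (β₀ γ₀ εy εv : ℝ) (s : State dx dy) : Vec dy :=
  subLoopOut (gradLinSys f g s.x (innerY g β₀ εy s)) s.v γ₀ εv

/-- One outer iteration. -/
def outerStep {dx dy : ℕ} (f g : Pair dx dy → ℝ) (β₀ γ₀ εy εv : ℝ) (s : State dx dy) :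
    State dx dy :=
  let y := innerY g β₀ εy s
  let v := innerV f g β₀ γ₀ εy εv s
  let h := hyperGrad f g s.x y v
  let α := √(s.α ^ 2 + ‖h‖ ^ 2)
  { x := s.x - (1 / α) • h, y := y, v := v, α := α }

/-- The state of D-TFBO at the start of outer iteration `t`. -/
def dtfbo {dx dy : ℕ} (f g : Pair dx dy → ℝ) (x₀ : Vec dx) (y₀ v₀ : Vec dy)
    (α₀ β₀ γ₀ εy εv : ℝ) : ℕ → State dx dy
  | 0 => { x := x₀, y := y₀, v := v₀, α := α₀ }
  | t + 1 => outerStep f g β₀ γ₀ εy εv (dtfbo f g x₀ y₀ v₀ α₀ β₀ γ₀ εy εv t)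

/-- In an outer iteration started from `s`, both while loops terminate. -/
def LoopsStop {dx dy : ℕ} (f g : Pair dx dy → ℝ) (β₀ γ₀ εy εv : ℝ) (s : State dx dy) : Prop :=
  SubLoopStops (gradY g s.x) s.y β₀ εy ∧
    SubLoopStops (gradLinSys f g s.x (innerY g β₀ εy s)) s.v γ₀ εv

/-! ### The constants -/

/-- `L_Φ = (L_{f,1} + L_{g,2} C_{f_y} / μ) (1 + C_{g_xy} / μ)²`. -/
def LPhi (μ Lf1 Lg2 Cfy Cgxy : ℝ) : ℝ :=
  (Lf1 + Lg2 * Cfy / μ) * (1 + Cgxy / μ) ^ 2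

/-- `L̄_v = L_{f,1} / μ + C_{f_y} L_{g,2} / μ²`. -/
def LbarV (μ Lf1 Lg2 Cfy : ℝ) : ℝ :=
  Lf1 / μ + Cfy * Lg2 / μ ^ 2

/-- `L̄ = max {2 (C_{f_y}² L_{g,2}² / μ² + L_{f,1}² + C_{g_xy}² L̄_v²)^{1/2}, 2 C_{g_xy}}`. -/
def Lbar (μ Lf1 Lg2 Cfy Cgxy : ℝ) : ℝ :=
  max (2 * √(Cfy ^ 2 * Lg2 ^ 2 / μ ^ 2 + Lf1 ^ 2 + Cgxy ^ 2 * LbarV μ Lf1 Lg2 Cfy ^ 2))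
    (2 * Cgxy)

/-- `C_α = max {2 L_Φ, α₀}`. -/
def Calpha (μ Lf1 Lg2 Cfy Cgxy α₀ : ℝ) : ℝ :=
  max (2 * LPhi μ Lf1 Lg2 Cfy Cgxy) α₀

/-- `c₀ = 2 Δ + L_Φ C_α² / (2 α₀²)`, where `Δ` stands for `Φ(x₀) - inf Φ`. -/
def cZero (μ Lf1 Lg2 Cfy Cgxy α₀ Δ : ℝ) : ℝ :=
  2 * Δ + LPhi μ Lf1 Lg2 Cfy Cgxy * Calpha μ Lf1 Lg2 Cfy Cgxy α₀ ^ 2 / (2 * α₀ ^ 2)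

/-- `c₁ = c₀ + (1 / α₀) [ ((2 / μ²) (L_{g,2} C_{f_y} / μ + L_{f,1}) + 1) L_{g,1}² L̄²
+ 2 L̄² / μ² ]`. -/
def cOne (μ Lf1 Lg1 Lg2 Cfy Cgxy α₀ Δ : ℝ) : ℝ :=
  cZero μ Lf1 Lg2 Cfy Cgxy α₀ Δ +
    1 / α₀ * ((2 / μ ^ 2 * (Lg2 * Cfy / μ + Lf1) + 1) * Lg1 ^ 2 * Lbar μ Lf1 Lg2 Cfy Cgxy ^ 2 +
      2 * Lbar μ Lf1 Lg2 Cfy Cgxy ^ 2 / μ ^ 2)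

end Bilevel

end

/-!
Strong convexity in `y` makes `y*(x)` the unique zero of `∇_y g(x, ·)`. It is Lipschitz
(`Regular.norm_lowerSol_sub_le`), and the implicit function theorem gives its derivative, so that
`∇Φ(x) = ∇_x f - ∇_x∇_y g (∇_y∇_y g)⁻¹ ∇_y f` at `(x, y*(x))` (`Regular.hasGradientAt_Phi`). The
Lipschitz assumptions turn this formula into the `L_Φ`-smoothness of `Φ`
(`Regular.norm_gradient_Phi_sub_le`).

Each sub-loop is gradient descent with the step size `1 / b_{p+1}`, `b_{p+1}² = b_p² + ‖∇φ(z_p)‖²`,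
on a function `φ` with `L`-Lipschitz gradient that is bounded below. If it never stopped, `b` would
tend to infinity; but as soon as `b ≥ L`, the descent lemma shows that `b + 2 φ` decreases, which
bounds `b` (`subLoopStops_of_lipschitz_gradient`).

When both sub-loops have stopped with squared residuals at most `1 / T`, strong convexity bounds the
distances of `y` to `y*(x)` and of `v` to the solution of the linear system, and the hypergradient
estimate differs from `∇Φ` by at most `2 L̄² / (μ² T)` in squared norm
(`Regular.norm_hyperGrad_sub_gradient_sq_le`). The outer loop is therefore an inexact adaptive
gradient descent on `Φ` with total squared error independent of `T`. Its analysis is a statement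
about real sequences (`sum_le_of_adaptive_descent`): weighting by `1 / α_{t+1}`, the squared
gradients sum to at most `c₁`, because steps with `α_{t+1} ≤ L_Φ` increase `Φ` by a bounded total
amount; and the steps with `α_{t+1} > C_α ≥ 2 L_Φ` decrease `Φ` enough to show
`α_T ≤ C_α + 2 c₁`. The product of the two bounds is the claim.
-/

noncomputable section

namespace Bilevel

/-! ### Smooth and strongly convex functions -/

/-- A positive multiple of `‖z‖²` dominates any linear term up to a constant. -/
lemma neg_le_inner_add_sq {E : Type*} [NormedAddCommGroup E]
    [InnerProductSpace ℝ E] {μ : ℝ} (hμ : 0 < μ) (b z : E) :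
    -(‖b‖ ^ 2 / (2 * μ)) ≤ ⟪b, z⟫_ℝ + μ / 2 * ‖z‖ ^ 2 := by
  have h1 := neg_le_of_abs_le (abs_real_inner_le_norm b z)
  have h2 : ‖b‖ ^ 2 / (2 * μ) - ‖b‖ * ‖z‖ + μ / 2 * ‖z‖ ^ 2
      = (‖b‖ - μ * ‖z‖) ^ 2 / (2 * μ) := by
    field_simp
    ring
  have h3 : 0 ≤ (‖b‖ - μ * ‖z‖) ^ 2 / (2 * μ) := by positivity
  linarith

section Hilbert

variable {E : Type*} [NormedAddCommGroup E] [InnerProductSpace ℝ E] [CompleteSpace E]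

/-- A function with gradient field `G`, restricted to a line. -/
lemma hasDerivAt_comp_line {φ : E → ℝ} {G : E → E} (hφ : ∀ z, HasGradientAt φ (G z) z)
    (x h : E) (t : ℝ) :
    HasDerivAt (fun t : ℝ => φ (x + t • h)) ⟪G (x + t • h), h⟫_ℝ t := by
  have h1 : HasDerivAt (fun t : ℝ => x + t • h) h t := by
    simpa using ((hasDerivAt_id t).smul_const h).const_add x
  exact ((hφ (x + t • h)).hasFDerivAt.comp_hasDerivAt t h1).congr_deriv (by simp)

/-- The descent lemma. -/
lemma le_quadratic_of_lipschitz_gradient {φ : E → ℝ} {G : E → E} {L : ℝ}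
    (hφ : ∀ z, HasGradientAt φ (G z) z) (hG : ∀ x y, ‖G x - G y‖ ≤ L * ‖x - y‖) (x h : E) :
    φ (x + h) ≤ φ x + ⟪G x, h⟫_ℝ + L / 2 * ‖h‖ ^ 2 := by
  let ψ : ℝ → ℝ := fun t => φ (x + t • h) - t * ⟪G x, h⟫_ℝ - L / 2 * ‖h‖ ^ 2 * t ^ 2
  have hψ : ∀ t, HasDerivAt ψ
      (⟪G (x + t • h), h⟫_ℝ - ⟪G x, h⟫_ℝ - L / 2 * ‖h‖ ^ 2 * (2 * t)) t := by
    intro t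
    have h1 := hasDerivAt_comp_line hφ x h t
    have h2 := (hasDerivAt_id t).mul_const ⟪G x, h⟫_ℝ
    have h3 := (hasDerivAt_pow 2 t).const_mul (L / 2 * ‖h‖ ^ 2)
    exact ((h1.sub h2).sub h3).congr_deriv (by simp)
  have hanti : AntitoneOn ψ (Set.Icc 0 1) := by
    refine antitoneOn_of_deriv_nonpos (convex_Icc 0 1)
      (fun t _ => (hψ t).continuousAt.continuousWithinAt)
      (fun t _ => (hψ t).differentiableAt.differentiableWithinAt) fun t ht => ?_
    rw [interior_Icc] at ht
    rw [(hψ t).deriv, ← inner_sub_left]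
    have h1 := real_inner_le_norm (G (x + t • h) - G x) h
    have h2 := hG (x + t • h) x
    rw [add_sub_cancel_left, norm_smul, Real.norm_of_nonneg ht.1.le] at h2
    nlinarith [mul_le_mul_of_nonneg_right h2 (norm_nonneg h)]
  have h01 := hanti (Set.left_mem_Icc.2 zero_le_one) (Set.right_mem_Icc.2 zero_le_one) zero_le_one
  simp only [ψ, one_smul, zero_smul, add_zero] at h01
  linarith

/-- The descent lemma along a step of length `1 / a` in direction `-h`. -/
lemma step_le_of_lipschitz_gradient {φ : E → ℝ} {G : E → E} {L : ℝ}
    (hφ : ∀ z, HasGradientAt φ (G z) z) (hG : ∀ x y, ‖G x - G y‖ ≤ L * ‖x - y‖) (x h : E)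
    (a : ℝ) :
    φ (x - (1 / a) • h) ≤ φ x - ⟪G x, h⟫_ℝ / a + L * ‖h‖ ^ 2 / (2 * a ^ 2) := by
  have h1 := le_quadratic_of_lipschitz_gradient hφ hG x (-((1 / a) • h))
  rw [← sub_eq_add_neg, inner_neg_right, norm_neg, real_inner_smul_right, norm_smul, mul_pow,
    Real.norm_eq_abs, sq_abs] at h1
  refine h1.trans_eq ?_
  rw [div_pow]
  ring

/-- The first-order characterization of strong convexity. -/
lemma _root_.StrongConvexOn.add_inner_add_le {φ : E → ℝ} {G : E → E} {μ : ℝ}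
    (hsc : StrongConvexOn Set.univ μ φ) (hφ : ∀ z, HasGradientAt φ (G z) z) (x y : E) :
    φ x + ⟪G x, y - x⟫_ℝ + μ / 2 * ‖y - x‖ ^ 2 ≤ φ y := by
  have hd := hasDerivAt_comp_line hφ x (y - x) 0
  rw [zero_smul, add_zero] at hd
  have hlim := hd.tendsto_slope_zero_right
  have hlim2 : Filter.Tendsto (fun t : ℝ => φ y - φ x - (1 - t) * (μ / 2 * ‖x - y‖ ^ 2))
      (nhdsWithin 0 (Set.Ioi 0)) (nhds (φ y - φ x - (1 - 0) * (μ / 2 * ‖x - y‖ ^ 2))) := by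
    apply Filter.Tendsto.mono_left _ nhdsWithin_le_nhds
    apply Continuous.tendsto
    fun_prop
  have hle := le_of_tendsto_of_tendsto hlim hlim2 ?_
  · rw [norm_sub_rev y x]
    linarith
  · filter_upwards [Ioo_mem_nhdsGT (zero_lt_one (α := ℝ))] with t ht
    have h1 := hsc.2 (Set.mem_univ x) (Set.mem_univ y) (sub_nonneg.2 ht.2.le) ht.1.le
      (sub_add_cancel 1 t)
    have h2 : (1 - t) • x + t • y = x + t • (y - x) := by module
    rw [h2] at h1
    simp only [smul_eq_mul, zero_add, zero_smul, add_zero] at h1 ⊢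
    rw [inv_mul_le_iff₀ ht.1]
    linarith

/-- The gradient of a strongly convex function is strongly monotone. -/
lemma _root_.StrongConvexOn.le_inner_gradient_sub {φ : E → ℝ} {G : E → E} {μ : ℝ}
    (hsc : StrongConvexOn Set.univ μ φ) (hφ : ∀ z, HasGradientAt φ (G z) z) (x y : E) :
    μ * ‖x - y‖ ^ 2 ≤ ⟪G x - G y, x - y⟫_ℝ := by
  have h1 := hsc.add_inner_add_le hφ x y
  have h2 := hsc.add_inner_add_le hφ y x
  have h3 : ⟪G x, y - x⟫_ℝ = -⟪G x, x - y⟫_ℝ := by rw [← inner_neg_right, neg_sub]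
  rw [norm_sub_rev y x, h3] at h1
  rw [inner_sub_left]
  linarith

/-- A lower bound on the gradient of a strongly convex function in terms of the distance. -/
lemma _root_.StrongConvexOn.mul_norm_sub_le {φ : E → ℝ} {G : E → E} {μ : ℝ}
    (hsc : StrongConvexOn Set.univ μ φ) (hφ : ∀ z, HasGradientAt φ (G z) z) (x y : E) :
    μ * ‖x - y‖ ≤ ‖G x - G y‖ := by
  have h1 := (hsc.le_inner_gradient_sub hφ x y).trans (real_inner_le_norm _ _)
  rcases (norm_nonneg (x - y)).eq_or_lt with h0 | h0
  · rw [← h0, mul_zero]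
    exact norm_nonneg _
  · exact le_of_mul_le_mul_right (by linarith [h1]) h0

lemma _root_.StrongConvexOn.bddBelow_range {φ : E → ℝ} {G : E → E} {μ : ℝ} (hμ : 0 < μ)
    (hsc : StrongConvexOn Set.univ μ φ) (hφ : ∀ z, HasGradientAt φ (G z) z) :
    BddBelow (Set.range φ) := by
  refine ⟨φ 0 - ‖G 0‖ ^ 2 / (2 * μ), ?_⟩
  rintro _ ⟨y, rfl⟩
  have h1 := hsc.add_inner_add_le hφ 0 y
  rw [sub_zero] at h1
  linarith [neg_le_inner_add_sq hμ (G 0) y]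

lemma _root_.StrongConvexOn.exists_forall_le [FiniteDimensional ℝ E] {φ : E → ℝ} {G : E → E}
    {μ : ℝ} (hμ : 0 < μ) (hsc : StrongConvexOn Set.univ μ φ)
    (hφ : ∀ z, HasGradientAt φ (G z) z) : ∃ y, ∀ y', φ y ≤ φ y' := by
  have : ProperSpace E := FiniteDimensional.proper ℝ E
  have hc : Continuous φ :=
    continuous_iff_continuousAt.2 fun z => (hφ z).differentiableAt.continuousAt
  refine hc.exists_forall_le ?_
  -- `φ` dominates `μ / 4 ‖·‖²` up to a constant
  have hlow : ∀ y, φ 0 - ‖G 0‖ ^ 2 / (2 * (μ / 2)) + μ / 4 * ‖y‖ ^ 2 ≤ φ y := fun y => by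
    have h1 := hsc.add_inner_add_le hφ 0 y
    rw [sub_zero] at h1
    linarith [neg_le_inner_add_sq (half_pos hμ) (G 0) y]
  refine Filter.tendsto_atTop_mono hlow (Filter.tendsto_atTop_add_const_left _ _ ?_)
  exact Filter.Tendsto.const_mul_atTop (by positivity)
    ((Filter.tendsto_pow_atTop two_ne_zero).comp tendsto_norm_cocompact_atTop)

end Hilbert

/-! ### Termination of the sub-loops -/

section SubLoop

variable {n : ℕ} {G : Vec n → Vec n} {z₀ : Vec n} {b₀ : ℝ}

lemma subLoop_snd_succ_sq (p : ℕ) :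
    (subLoop G z₀ b₀ (p + 1)).2 ^ 2
      = (subLoop G z₀ b₀ p).2 ^ 2 + ‖G (subLoop G z₀ b₀ p).1‖ ^ 2 :=
  Real.sq_sqrt (by positivity)

lemma subLoop_fst_succ (p : ℕ) :
    (subLoop G z₀ b₀ (p + 1)).1
      = (subLoop G z₀ b₀ p).1
        - (1 / (subLoop G z₀ b₀ (p + 1)).2) • G (subLoop G z₀ b₀ p).1 := rfl

lemma subLoop_snd_pos (hb : 0 < b₀) : ∀ p, 0 < (subLoop G z₀ b₀ p).2
  | 0 => hb
  | p + 1 => Real.sqrt_pos.2 (by have := subLoop_snd_pos hb p; positivity)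

/-- If the accumulator of an adaptive step size grows from `b` to `b'`, then it grows by at most
the squared gradient norm over `b'`. -/
lemma le_add_div_of_sq_eq {b b' s : ℝ} (hb : 0 < b) (hb' : 0 < b') (hs : 0 ≤ s)
    (h : b' ^ 2 = b ^ 2 + s) : b' ≤ b + s / b' := by
  have h1 : b ≤ b' := by nlinarith
  have h2 : b' * (b + s / b') = b * b' + s := by
    field_simp
  refine le_of_mul_le_mul_left ?_ hb'
  rw [h2]
  nlinarith

/-- Gradient descent with the norm-adaptive step size terminates on every smooth function that is
bounded below. If it did not, the accumulator `b` would be unbounded; but once `b ≥ L`, the quantity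
`b + 2 φ` decreases. -/
lemma subLoopStops_of_lipschitz_gradient {φ : Vec n → ℝ} {L ε : ℝ}
    (hφ : ∀ z, HasGradientAt φ (G z) z) (hG : ∀ x y, ‖G x - G y‖ ≤ L * ‖x - y‖)
    (hbdd : BddBelow (Set.range φ)) (hb : 0 < b₀) (hε : 0 < ε) : SubLoopStops G z₀ b₀ ε := by
  by_contra hcon
  simp only [SubLoopStops, not_exists, not_le] at hcon
  set z : ℕ → Vec n := fun p => (subLoop G z₀ b₀ p).1 with hz
  set b : ℕ → ℝ := fun p => (subLoop G z₀ b₀ p).2 with hbdef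
  have hpos : ∀ p, 0 < b p := subLoop_snd_pos hb
  have hsq : ∀ p, b (p + 1) ^ 2 = b p ^ 2 + ‖G (z p)‖ ^ 2 := subLoop_snd_succ_sq
  have hgrow : ∀ p : ℕ, p * ε ≤ b p ^ 2 := by
    intro p
    induction p with
    | zero => simpa using sq_nonneg (b 0)
    | succ p ih =>
      rw [hsq p]
      push_cast
      linarith [hcon p]
  have hexceed : ∀ M : ℝ, ∃ N : ℕ, ∀ p ≥ N, M < b p := by
    intro M
    obtain ⟨N, hN⟩ := exists_nat_gt (M ^ 2 / ε)
    refine ⟨N, fun p hp => lt_of_pow_lt_pow_left₀ 2 (hpos p).le ?_⟩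
    rw [div_lt_iff₀ hε] at hN
    have : (N : ℝ) * ε ≤ p * ε := by gcongr
    linarith [hgrow p]
  obtain ⟨N, hN⟩ := hexceed L
  have hdec : ∀ k, b (N + k) + 2 * φ (z (N + k)) ≤ b N + 2 * φ (z N) := by
    intro k
    induction k with
    | zero => simp
    | succ k ih =>
      rw [← add_assoc]
      refine le_trans ?_ ih
      have hL := hN (N + k + 1) (by omega)
      have hp := hpos (N + k + 1)
      have h1 := le_add_div_of_sq_eq (hpos (N + k)) hp (sq_nonneg _) (hsq (N + k))
      have h2 := step_le_of_lipschitz_gradient hφ hG (z (N + k)) (G (z (N + k))) (b (N + k + 1))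
      have hz1 : z (N + k + 1) = z (N + k) - (1 / b (N + k + 1)) • G (z (N + k)) :=
        subLoop_fst_succ _
      rw [← hz1, real_inner_self_eq_norm_sq] at h2
      have h3 : L * ‖G (z (N + k))‖ ^ 2 / (2 * b (N + k + 1) ^ 2)
          ≤ ‖G (z (N + k))‖ ^ 2 / b (N + k + 1) / 2 := by
        rw [div_div, div_le_div_iff₀ (by positivity) (by positivity)]
        nlinarith [mul_nonneg (mul_nonneg (sq_nonneg ‖G (z (N + k))‖) hp.le) (sub_nonneg.2 hL.le)]
      linarith
  obtain ⟨m, hm⟩ := hbdd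
  obtain ⟨K, hK⟩ := hexceed (b N + 2 * φ (z N) - 2 * m)
  have h1 := hK (N + K) (by omega)
  have h2 := hdec K
  have h3 : m ≤ φ (z (N + K)) := hm ⟨_, rfl⟩
  linarith

/-- A terminating loop is left at a point satisfying its stopping test. -/
lemma SubLoopStops.norm_sq_le {ε : ℝ} (h : SubLoopStops G z₀ b₀ ε) :
    ‖G (subLoopOut G z₀ b₀ ε)‖ ^ 2 ≤ ε :=
  Nat.sInf_mem (s := {p | ‖G (subLoop G z₀ b₀ p).1‖ ^ 2 ≤ ε}) h

end SubLoop

/-! ### Inexact gradient descent with adaptive step size -/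

/-- The scalar recursion behind the outer loop. Here `G t`, `H t` and `e` stand for the squared
norms of the gradient, of the direction used, and of their difference. Steps with `a (t + 1) ≤ L`
may increase `φ`, by a total of order `L ^ 3 / a 0 ^ 2`; steps with `a (t + 1) > C` decrease it by
enough to pay for the growth of `a` beyond `C`. -/
lemma sum_le_of_adaptive_descent {a φ G H : ℕ → ℝ} {L C e m : ℝ} {T : ℕ}
    (ha0 : 0 < a 0) (hpos : ∀ t, 0 < a t) (hsq : ∀ t, a (t + 1) ^ 2 = a t ^ 2 + H t)
    (hG : ∀ t, 0 ≤ G t) (hH : ∀ t, 0 ≤ H t) (hL : 0 ≤ L) (he : 0 ≤ e)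
    (hLC : 2 * L ≤ C) (haC : a 0 ≤ C)
    (hdesc : ∀ t < T, φ (t + 1)
      ≤ φ t - (G t + H t - e) / (2 * a (t + 1)) + L * H t / (2 * a (t + 1) ^ 2))
    (hm : m ≤ φ T) {K : ℝ}
    (hK : 2 * (φ 0 - m) + L * C ^ 2 / (2 * a 0 ^ 2) + T * (e / a 0) ≤ K) :
    ∑ t ∈ Finset.range T, G t ≤ K * (C + 2 * K) := by
  have hmono : Monotone a := monotone_nat_of_le_succ fun t => by
    refine le_of_sq_le_sq ?_ (hpos _).le
    linarith [hsq t, hH t]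
  have ha0le : ∀ t, a 0 ≤ a t := fun t => hmono (Nat.zero_le t)
  -- progress made by the steps with a large accumulator
  set B : ℕ → ℝ := fun n => ∑ t ∈ Finset.range n, if C < a (t + 1) then H t / a (t + 1) else 0
  -- squared lengths of the directions of the steps with a small accumulator
  set S : ℕ → ℝ := fun n => ∑ t ∈ Finset.range n, if a (t + 1) ≤ L then H t else 0
  set A : ℕ → ℝ := fun n => ∑ t ∈ Finset.range n, G t / a (t + 1)
  have hAs : ∀ n, A (n + 1) = A n + G n / a (n + 1) := fun n => Finset.sum_range_succ _ _
  have hBs : ∀ n, B (n + 1) = B n + if C < a (n + 1) then H n / a (n + 1) else 0 :=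
    fun n => Finset.sum_range_succ _ _
  have hSs : ∀ n, S (n + 1) = S n + if a (n + 1) ≤ L then H n else 0 :=
    fun n => Finset.sum_range_succ _ _
  have hB0 : ∀ n, 0 ≤ B n := fun n => Finset.sum_nonneg fun t _ => by
    have := hH t; have := hpos (t + 1)
    split_ifs <;> positivity
  have hA0 : ∀ n, 0 ≤ A n := fun n => Finset.sum_nonneg fun t _ => by
    have := hG t; have := hpos (t + 1)
    positivity
  have haB : ∀ n, a n ≤ C + B n := by
    intro n
    induction n with
    | zero => simpa [B] using haC
    | succ n ih =>
      rw [hBs n]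
      split_ifs with h
      · linarith [le_add_div_of_sq_eq (hpos n) (hpos (n + 1)) (hH n) (hsq n)]
      · linarith [hB0 n]
  have hS : ∀ n, S n ≤ a n ^ 2 ∧ S n ≤ L ^ 2 := by
    intro n
    induction n with
    | zero => simp only [S, Finset.range_zero, Finset.sum_empty]; constructor <;> positivity
    | succ n ih =>
      rw [hSs n]
      split_ifs with h
      · have h1 : S n + H n ≤ a (n + 1) ^ 2 := by linarith [hsq n, ih.1]
        exact ⟨h1, h1.trans (pow_le_pow_left₀ (hpos _).le h 2)⟩
      · rw [add_zero]
        exact ⟨by linarith [ih.1, hsq n, hH n], ih.2⟩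
  have hmain : ∀ n ≤ T, A n + B n / 2 ≤ 2 * (φ 0 - φ n) + L / a 0 ^ 2 * S n + n * (e / a 0) := by
    intro n
    induction n with
    | zero => intro _; simp [A, B, S]
    | succ n ih =>
      intro hn
      have ih := ih (by omega)
      have hd := hdesc n (by omega)
      have hp := hpos (n + 1)
      have hHn := hH n
      have h0 := ha0le (n + 1)
      have he1 : e / a (n + 1) ≤ e / a 0 := by gcongr
      have hsplit : (G n + H n - e) / (2 * a (n + 1)) * 2
          = G n / a (n + 1) + H n / a (n + 1) - e / a (n + 1) := by
        field_simp
      have hsplit2 : L * H n / (2 * a (n + 1) ^ 2) * 2 = L * H n / a (n + 1) ^ 2 := by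
        field_simp
      have hbig : L < a (n + 1) → L * H n / a (n + 1) ^ 2 ≤ H n / a (n + 1) := by
        intro h
        rw [div_le_div_iff₀ (by positivity) hp]
        nlinarith [mul_nonneg (mul_nonneg hHn hp.le) (sub_nonneg.2 h.le)]
      have hkey : (if C < a (n + 1) then H n / a (n + 1) else 0) / 2 + L * H n / a (n + 1) ^ 2
          ≤ H n / a (n + 1) + L / a 0 ^ 2 * (if a (n + 1) ≤ L then H n else 0) := by
        by_cases h1 : C < a (n + 1)
        · have h2 : ¬ a (n + 1) ≤ L := by linarith
          rw [if_pos h1, if_neg h2]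
          have h3 : L * H n / a (n + 1) ^ 2 ≤ H n / a (n + 1) / 2 := by
            rw [div_div, div_le_div_iff₀ (by positivity) (by positivity)]
            nlinarith [mul_nonneg (mul_nonneg hHn hp.le)
              (sub_nonneg.2 (hLC.trans h1.le))]
          linarith
        · rw [if_neg h1]
          by_cases h2 : a (n + 1) ≤ L
          · rw [if_pos h2]
            have h3 : L * H n / a (n + 1) ^ 2 ≤ L * H n / a 0 ^ 2 := by gcongr
            have h4 : 0 ≤ H n / a (n + 1) := by positivity
            have h5 : L / a 0 ^ 2 * H n = L * H n / a 0 ^ 2 := by ring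
            linarith
          · rw [if_neg h2]
            linarith [hbig (not_le.1 h2)]
      rw [hAs, hBs, hSs]
      push_cast
      rw [mul_add, add_mul, add_div]
      linarith
  have hT : A T + B T / 2 ≤ K := by
    refine (hmain T le_rfl).trans (le_trans ?_ hK)
    have h1 : L / a 0 ^ 2 * S T ≤ L * C ^ 2 / (2 * a 0 ^ 2) := by
      have h2 : S T ≤ C ^ 2 / 2 := by nlinarith [(hS T).2]
      calc L / a 0 ^ 2 * S T ≤ L / a 0 ^ 2 * (C ^ 2 / 2) := by gcongr
        _ = _ := by field_simp
    linarith
  have hAT : A T ≤ K := by linarith [hB0 T]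
  have hK0 : 0 ≤ K := (hA0 T).trans hAT
  have haT : a T ≤ C + 2 * K := by linarith [haB T, hA0 T]
  calc ∑ t ∈ Finset.range T, G t ≤ ∑ t ∈ Finset.range T, G t / a (t + 1) * a T := by
        refine Finset.sum_le_sum fun t ht => ?_
        have h1 : a (t + 1) ≤ a T := hmono (Finset.mem_range.1 ht)
        rw [div_mul_eq_mul_div, le_div_iff₀ (hpos _)]
        exact mul_le_mul_of_nonneg_left h1 (hG t)
    _ = A T * a T := by rw [← Finset.sum_mul]
    _ ≤ K * (C + 2 * K) := mul_le_mul hAT haT (hpos T).le hK0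

/-! ### Partial gradients and second derivatives -/

section Partial

variable {dx dy : ℕ}

lemma pair_sub_pair (x x' : Vec dx) (y y' : Vec dy) :
    pair x y - pair x' y' = pair (x - x') (y - y') := rfl

lemma norm_pair_le (x : Vec dx) (y : Vec dy) : ‖pair x y‖ ≤ ‖x‖ + ‖y‖ := by
  rw [WithLp.prod_norm_eq_of_L2, Real.sqrt_le_left (by positivity)]
  simp only [WithLp.toLp_fst, WithLp.toLp_snd]
  nlinarith [norm_nonneg x, norm_nonneg y]

lemma norm_pair_zero_left (y : Vec dy) : ‖pair (0 : Vec dx) y‖ = ‖y‖ := by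
  simp

lemma hasFDerivAt_pair_left (x : Vec dx) (y : Vec dy) :
    HasFDerivAt (fun x' => pair x' y)
      ((WithLp.prodContinuousLinearEquiv 2 ℝ (Vec dx) (Vec dy)).symm.toContinuousLinearMap ∘L
        ContinuousLinearMap.inl ℝ (Vec dx) (Vec dy)) x :=
  (WithLp.prodContinuousLinearEquiv 2 ℝ (Vec dx) (Vec dy)).symm.hasFDerivAt.comp x
    (hasFDerivAt_prodMk_left x y)

lemma hasFDerivAt_pair_right (x : Vec dx) (y : Vec dy) :
    HasFDerivAt (fun y' => pair x y')
      ((WithLp.prodContinuousLinearEquiv 2 ℝ (Vec dx) (Vec dy)).symm.toContinuousLinearMap ∘L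
        ContinuousLinearMap.inr ℝ (Vec dx) (Vec dy)) y :=
  (WithLp.prodContinuousLinearEquiv 2 ℝ (Vec dx) (Vec dy)).symm.hasFDerivAt.comp y
    (hasFDerivAt_prodMk_right x y)

variable {h : Pair dx dy → ℝ}

lemma hasGradientAt_left (hh : Differentiable ℝ h) (x : Vec dx) (y : Vec dy) :
    HasGradientAt (fun x' => h (pair x' y)) (∇ h (pair x y)).fst x := by
  rw [hasGradientAt_iff_hasFDerivAt]
  refine ((hh (pair x y)).hasGradientAt.hasFDerivAt.comp x
    (hasFDerivAt_pair_left x y)).congr_fderiv ?_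
  refine ContinuousLinearMap.ext fun u => ?_
  rw [ContinuousLinearMap.comp_apply, InnerProductSpace.toDual_apply_apply,
    InnerProductSpace.toDual_apply_apply]
  simp [WithLp.prod_inner_apply, -inner_gradient_left]

lemma hasGradientAt_right (hh : Differentiable ℝ h) (x : Vec dx) (y : Vec dy) :
    HasGradientAt (fun y' => h (pair x y')) (∇ h (pair x y)).snd y := by
  rw [hasGradientAt_iff_hasFDerivAt]
  refine ((hh (pair x y)).hasGradientAt.hasFDerivAt.comp y
    (hasFDerivAt_pair_right x y)).congr_fderiv ?_
  refine ContinuousLinearMap.ext fun u => ?_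
  rw [ContinuousLinearMap.comp_apply, InnerProductSpace.toDual_apply_apply,
    InnerProductSpace.toDual_apply_apply]
  simp [WithLp.prod_inner_apply, -inner_gradient_left]

lemma gradX_eq (hh : Differentiable ℝ h) (x : Vec dx) (y : Vec dy) :
    gradX h x y = (∇ h (pair x y)).fst := (hasGradientAt_left hh x y).gradient

lemma gradY_eq (hh : Differentiable ℝ h) (x : Vec dx) (y : Vec dy) :
    gradY h x y = (∇ h (pair x y)).snd := (hasGradientAt_right hh x y).gradient

lemma hasGradientAt_gradY (hh : Differentiable ℝ h) (x : Vec dx) (y : Vec dy) :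
    HasGradientAt (fun y' => h (pair x y')) (gradY h x y) y := by
  rw [gradY_eq hh]
  exact hasGradientAt_right hh x y

lemma norm_gradX_sub_le (hh : Differentiable ℝ h) {L : ℝ≥0} (hL : LipschitzWith L (∇ h))
    (x x' : Vec dx) (y y' : Vec dy) :
    ‖gradX h x y - gradX h x' y'‖ ≤ L * ‖pair x y - pair x' y'‖ := by
  rw [gradX_eq hh, gradX_eq hh, ← WithLp.sub_fst]
  exact (WithLp.norm_fst_le _ _).trans (hL.norm_sub_le _ _)

lemma norm_gradY_sub_le (hh : Differentiable ℝ h) {L : ℝ≥0} (hL : LipschitzWith L (∇ h))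
    (x x' : Vec dx) (y y' : Vec dy) :
    ‖gradY h x y - gradY h x' y'‖ ≤ L * ‖pair x y - pair x' y'‖ := by
  rw [gradY_eq hh, gradY_eq hh, ← WithLp.sub_snd]
  exact (WithLp.norm_snd_le _ _).trans (hL.norm_sub_le _ _)

lemma differentiable_gradient {E : Type*} [NormedAddCommGroup E] [InnerProductSpace ℝ E]
    [CompleteSpace E] {φ : E → ℝ} (hφ : ContDiff ℝ 2 φ) : Differentiable ℝ (∇ φ) := by
  have h1 : Differentiable ℝ (fderiv ℝ φ) :=
    (hφ.fderiv_right (m := 1) (by norm_num)).differentiable (by norm_num)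
  exact (InnerProductSpace.toDual ℝ E).symm.toContinuousLinearEquiv.toContinuousLinearMap
    |>.differentiable.comp h1

lemma differentiableAt_gradY (hh : ContDiff ℝ 2 h) (z : Pair dx dy) :
    DifferentiableAt ℝ (fun z : Pair dx dy => gradY h z.fst z.snd) z := by
  have h1 : (fun z : Pair dx dy => gradY h z.fst z.snd)
      = fun z => WithLp.sndL 2 ℝ (Vec dx) (Vec dy) (∇ h z) := by
    ext1 z
    exact gradY_eq (hh.differentiable (by norm_num)) z.fst z.snd
  rw [h1]
  exact (WithLp.sndL 2 ℝ (Vec dx) (Vec dy)).differentiableAt.comp z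
    (differentiable_gradient hh z)

/-- The blocks of the derivative of `∇_y h` are the transpose of `∇_x ∇_y h` and `∇_y ∇_y h`. -/
lemma hasFDerivAt_gradY (hh : ContDiff ℝ 2 h) (x : Vec dx) (y : Vec dy) :
    HasFDerivAt (fun z : Pair dx dy => gradY h z.fst z.snd)
      (ContinuousLinearMap.adjoint (hessXY h x y) ∘L WithLp.fstL 2 ℝ (Vec dx) (Vec dy)
        + hessYY h x y ∘L WithLp.sndL 2 ℝ (Vec dx) (Vec dy)) (pair x y) := by
  have hd := (differentiableAt_gradY hh (pair x y)).hasFDerivAt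
  have h1 := (hd.comp x (hasFDerivAt_pair_left x y)).fderiv
  have h2 := (hd.comp y (hasFDerivAt_pair_right x y)).fderiv
  refine hd.congr_fderiv ?_
  rw [hessXY, ContinuousLinearMap.adjoint_adjoint, hessYY]
  refine ContinuousLinearMap.ext fun z => ?_
  have h3 : z = pair z.fst 0 + pair 0 z.snd := by
    apply WithLp.ofLp_injective
    ext1 <;> simp
  have h1' := DFunLike.congr_fun h1 z.fst
  have h2' := DFunLike.congr_fun h2 z.snd
  conv_lhs => rw [h3, map_add]
  exact (congrArg₂ (· + ·) h1' h2').symm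

lemma hasFDerivAt_gradY_right (hh : ContDiff ℝ 2 h) (x : Vec dx) (y : Vec dy) :
    HasFDerivAt (fun y' => gradY h x y') (hessYY h x y) y :=
  ((differentiableAt_gradY hh (pair x y)).comp y
    (hasFDerivAt_pair_right x y).differentiableAt).hasFDerivAt

lemma hasFDerivAt_gradY_left (hh : ContDiff ℝ 2 h) (x : Vec dx) (y : Vec dy) :
    HasFDerivAt (fun x' => gradY h x' y) (ContinuousLinearMap.adjoint (hessXY h x y)) x := by
  rw [hessXY, ContinuousLinearMap.adjoint_adjoint]
  exact ((differentiableAt_gradY hh (pair x y)).comp x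
    (hasFDerivAt_pair_left x y).differentiableAt).hasFDerivAt

lemma inner_hessYY_comm (hh : ContDiff ℝ 2 h) (x : Vec dx) (y u w : Vec dy) :
    ⟪hessYY h x y u, w⟫_ℝ = ⟪u, hessYY h x y w⟫_ℝ := by
  set φ : Vec dy → ℝ := fun y' => h (pair x y')
  have hφ : ContDiff ℝ 2 φ := hh.comp
    ((WithLp.prodContinuousLinearEquiv 2 ℝ (Vec dx) (Vec dy)).symm.contDiff.comp
      (contDiff_prodMk_right x))
  have hsymm : IsSymmSndFDerivAt ℝ φ y := hφ.contDiffAt.isSymmSndFDerivAt (by simp)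
  have h1 : Differentiable ℝ (fderiv ℝ φ) :=
    (hφ.fderiv_right (m := 1) (by norm_num)).differentiable (by norm_num)
  -- `⟪∇ φ, w⟫` and `Dφ w` are the same function; differentiate both
  have h2 : ∀ u w, ⟪hessYY h x y u, w⟫_ℝ = fderiv ℝ (fderiv ℝ φ) y u w := by
    intro u w
    have h3 := (hasFDerivAt_gradY_right hh x y).inner ℝ (hasFDerivAt_const w y)
    have h4 := (h1 y).hasFDerivAt.clm_apply (hasFDerivAt_const w y)
    have h5 : (fun y' => ⟪gradY h x y', w⟫_ℝ) = fun y' => fderiv ℝ φ y' w := by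
      ext1 y'
      exact inner_gradient_left
    rw [h5] at h3
    simpa using DFunLike.congr_fun (h3.unique h4) u
  rw [real_inner_comm _ u, h2, h2, hsymm.eq]

/-- The Hessian of a strongly convex function is bounded below. -/
lemma le_inner_hessYY (hh : ContDiff ℝ 2 h) {μ : ℝ} {x : Vec dx}
    (hsc : StrongConvexOn Set.univ μ (fun y => h (pair x y))) (y v : Vec dy) :
    μ * ‖v‖ ^ 2 ≤ ⟪hessYY h x y v, v⟫_ℝ := by
  have hline : HasDerivAt (fun t : ℝ => y + t • v) v 0 := by
    simpa using ((hasDerivAt_id (0 : ℝ)).smul_const v).const_add y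
  have h0 : HasFDerivAt (fun y' => gradY h x y') (hessYY h x y) (y + (0 : ℝ) • v) := by
    rw [zero_smul, add_zero]
    exact hasFDerivAt_gradY_right hh x y
  have h1 : HasDerivAt (fun t : ℝ => ⟪gradY h x (y + t • v), v⟫_ℝ) ⟪hessYY h x y v, v⟫_ℝ 0 :=
    ((h0.comp_hasDerivAt (0 : ℝ) hline).inner ℝ (hasDerivAt_const (0 : ℝ) v)).congr_deriv (by simp)
  refine ge_of_tendsto h1.tendsto_slope_zero_right ?_
  filter_upwards [self_mem_nhdsWithin] with t ht
  have ht : 0 < t := ht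
  have h2 := hsc.le_inner_gradient_sub
    (fun y => hasGradientAt_gradY (hh.differentiable (by norm_num)) x y) (y + t • v) y
  rw [add_sub_cancel_left, norm_smul, mul_pow, Real.norm_eq_abs, sq_abs,
    real_inner_smul_right, inner_sub_left] at h2
  simp only [zero_add, zero_smul, add_zero, smul_eq_mul]
  rw [le_inv_mul_iff₀ ht]
  refine le_of_mul_le_mul_left ?_ ht
  linarith

end Partial

/-! ### The linear system -/

/-- The standing assumptions on the upper and lower level objectives, without the bound on
`Φ`. -/
structure Regular {dx dy : ℕ} (f g : Pair dx dy → ℝ) (μ : ℝ) (Lf1 Lg1 Lg2 : ℝ≥0)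
    (Cfy Cgxy : ℝ) : Prop where
  μ_pos : 0 < μ
  contDiff_f : ContDiff ℝ 2 f
  contDiff_g : ContDiff ℝ 2 g
  strongConvex : ∀ x : Vec dx, StrongConvexOn Set.univ μ (fun y => g (pair x y))
  lip_f : LipschitzWith Lf1 (∇ f)
  lip_g : LipschitzWith Lg1 (∇ g)
  lip_xy : LipschitzWith Lg2 (fun z : Pair dx dy => hessXY g z.fst z.snd)
  lip_yy : LipschitzWith Lg2 (fun z : Pair dx dy => hessYY g z.fst z.snd)
  gradY_le : ∀ x y, ‖gradY f x y‖ ≤ Cfy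
  hessXY_le : ∀ x y, ‖hessXY g x y‖ ≤ Cgxy

/-- The solution `(∇_y ∇_y g)⁻¹ ∇_y f` of the linear system, that is, the minimizer of
`R(x, y, ·)`. -/
def linSol {dx dy : ℕ} (f g : Pair dx dy → ℝ) (x : Vec dx) (y : Vec dy) : Vec dy :=
  (hessYY g x y).inverse (gradY f x y)

namespace Regular

variable {dx dy : ℕ} {f g : Pair dx dy → ℝ} {μ : ℝ} {Lf1 Lg1 Lg2 : ℝ≥0} {Cfy Cgxy : ℝ}

lemma differentiable_f (h : Regular f g μ Lf1 Lg1 Lg2 Cfy Cgxy) : Differentiable ℝ f :=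
  h.contDiff_f.differentiable (by norm_num)

lemma differentiable_g (h : Regular f g μ Lf1 Lg1 Lg2 Cfy Cgxy) : Differentiable ℝ g :=
  h.contDiff_g.differentiable (by norm_num)

lemma Cfy_nonneg (h : Regular f g μ Lf1 Lg1 Lg2 Cfy Cgxy) : 0 ≤ Cfy :=
  (norm_nonneg _).trans (h.gradY_le 0 0)

lemma Cgxy_nonneg (h : Regular f g μ Lf1 Lg1 Lg2 Cfy Cgxy) : 0 ≤ Cgxy :=
  (norm_nonneg _).trans (h.hessXY_le 0 0)

lemma mul_norm_le_norm_hessYY (h : Regular f g μ Lf1 Lg1 Lg2 Cfy Cgxy) (x : Vec dx)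
    (y v : Vec dy) : μ * ‖v‖ ≤ ‖hessYY g x y v‖ := by
  have h1 := (le_inner_hessYY h.contDiff_g (h.strongConvex x) y v).trans (real_inner_le_norm _ _)
  rcases (norm_nonneg v).eq_or_lt with h0 | h0
  · rw [← h0, mul_zero]
    exact norm_nonneg _
  · exact le_of_mul_le_mul_right (by linarith [h1]) h0

/-- Bounds on `v` from bounds on `∇_y ∇_y g v`. -/
lemma norm_le_of_hessYY (h : Regular f g μ Lf1 Lg1 Lg2 Cfy Cgxy) {x : Vec dx} {y v : Vec dy}
    {r : ℝ} (hr : ‖hessYY g x y v‖ ≤ r) : ‖v‖ ≤ r / μ := by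
  rw [le_div_iff₀ h.μ_pos, mul_comm]
  exact (h.mul_norm_le_norm_hessYY x y v).trans hr

lemma exists_equiv_hessYY (h : Regular f g μ Lf1 Lg1 Lg2 Cfy Cgxy) (x : Vec dx) (y : Vec dy) :
    ∃ e : Vec dy ≃L[ℝ] Vec dy, (e : Vec dy →L[ℝ] Vec dy) = hessYY g x y := by
  have hinj : Function.Injective (hessYY g x y : Vec dy →ₗ[ℝ] Vec dy) := by
    refine (injective_iff_map_eq_zero _).2 fun v hv => ?_
    have h1 := h.norm_le_of_hessYY (x := x) (y := y) (v := v) (r := 0) (by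
      have hv' : hessYY g x y v = 0 := hv
      rw [hv', norm_zero])
    rw [zero_div] at h1
    exact norm_le_zero_iff.1 h1
  refine ⟨(LinearEquiv.ofInjectiveEndo _ hinj).toContinuousLinearEquiv, ?_⟩
  ext v
  simp

lemma hessYY_linSol (h : Regular f g μ Lf1 Lg1 Lg2 Cfy Cgxy) (x : Vec dx) (y : Vec dy) :
    hessYY g x y (linSol f g x y) = gradY f x y := by
  obtain ⟨e, he⟩ := h.exists_equiv_hessYY x y
  rw [linSol, ← he, ContinuousLinearMap.inverse_equiv]
  exact e.apply_symm_apply _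

lemma norm_linSol_le (h : Regular f g μ Lf1 Lg1 Lg2 Cfy Cgxy) (x : Vec dx) (y : Vec dy) :
    ‖linSol f g x y‖ ≤ Cfy / μ :=
  h.norm_le_of_hessYY (by rw [h.hessYY_linSol]; exact h.gradY_le x y)

lemma norm_hessYY_sub_le (h : Regular f g μ Lf1 Lg1 Lg2 Cfy Cgxy) (x x' : Vec dx)
    (y y' : Vec dy) : ‖hessYY g x y - hessYY g x' y'‖ ≤ Lg2 * ‖pair x y - pair x' y'‖ :=
  h.lip_yy.norm_sub_le (pair x y) (pair x' y')

lemma norm_hessXY_sub_le (h : Regular f g μ Lf1 Lg1 Lg2 Cfy Cgxy) (x x' : Vec dx)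
    (y y' : Vec dy) : ‖hessXY g x y - hessXY g x' y'‖ ≤ Lg2 * ‖pair x y - pair x' y'‖ :=
  h.lip_xy.norm_sub_le (pair x y) (pair x' y')

/-- `L̄_v` is a Lipschitz constant of the solution of the linear system. -/
lemma norm_linSol_sub_le (h : Regular f g μ Lf1 Lg1 Lg2 Cfy Cgxy) (x x' : Vec dx)
    (y y' : Vec dy) :
    ‖linSol f g x y - linSol f g x' y'‖ ≤ LbarV μ Lf1 Lg2 Cfy * ‖pair x y - pair x' y'‖ := by
  set d := ‖pair x y - pair x' y'‖ with hd
  have hμ := h.μ_pos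
  have h1 : hessYY g x y (linSol f g x y - linSol f g x' y')
      = (gradY f x y - gradY f x' y') - (hessYY g x y - hessYY g x' y') (linSol f g x' y') := by
    rw [map_sub, h.hessYY_linSol, _root_.sub_apply, h.hessYY_linSol]
    abel
  have h2 : ‖hessYY g x y (linSol f g x y - linSol f g x' y')‖
      ≤ Lf1 * d + Lg2 * d * (Cfy / μ) := by
    rw [h1]
    refine (norm_sub_le _ _).trans (add_le_add
      (norm_gradY_sub_le h.differentiable_f h.lip_f x x' y y') ?_)
    refine (ContinuousLinearMap.le_opNorm _ _).trans ?_
    exact mul_le_mul (h.norm_hessYY_sub_le x x' y y') (h.norm_linSol_le x' y') (norm_nonneg _)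
      (by positivity)
  refine (h.norm_le_of_hessYY h2).trans_eq ?_
  rw [LbarV]
  field_simp

lemma gradLinSys_eq (h : Regular f g μ Lf1 Lg1 Lg2 Cfy Cgxy) (x : Vec dx) (y v : Vec dy) :
    HasGradientAt (fun v' => linSys f g x y v') (hessYY g x y v - gradY f x y) v ∧
      gradLinSys f g x y v = hessYY g x y v - gradY f x y := by
  have h1 : HasGradientAt (fun v' => linSys f g x y v') (hessYY g x y v - gradY f x y) v := by
    rw [hasGradientAt_iff_hasFDerivAt]
    have h2 := ((hasFDerivAt_id v).inner ℝ (hessYY g x y).hasFDerivAt).const_mul (1 / 2 : ℝ)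
    have h3 := (hasFDerivAt_id v).inner ℝ (hasFDerivAt_const (gradY f x y) v)
    refine (h2.sub h3).congr_fderiv ?_
    refine ContinuousLinearMap.ext fun u => ?_
    rw [InnerProductSpace.toDual_apply_apply, inner_sub_left, real_inner_comm _ (gradY f x y)]
    have h4 := inner_hessYY_comm h.contDiff_g x y v u
    have h5 := real_inner_comm u (hessYY g x y v)
    simp only [id_eq, _root_.sub_apply, _root_.smul_apply,
      ContinuousLinearMap.comp_apply, ContinuousLinearMap.prod_apply, fderivInnerCLM_apply,
      ContinuousLinearMap.id_apply, _root_.zero_apply, inner_zero_right,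
      smul_eq_mul, zero_add]
    linarith
  exact ⟨h1, h1.gradient⟩

/-- Both sub-loops minimize smooth functions that are bounded below: `g(x, ·)` and `R(x, y, ·)`. -/
lemma loopsStop (h : Regular f g μ Lf1 Lg1 Lg2 Cfy Cgxy) {β₀ γ₀ ε : ℝ} (hβ : 0 < β₀)
    (hγ : 0 < γ₀) (hε : 0 < ε) (s : State dx dy) : LoopsStop f g β₀ γ₀ ε ε s := by
  constructor
  · have hgrad := hasGradientAt_gradY h.differentiable_g s.x
    refine subLoopStops_of_lipschitz_gradient (L := Lg1) hgrad (fun y y' => ?_)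
      ((h.strongConvex s.x).bddBelow_range h.μ_pos hgrad) hβ hε
    have h1 := norm_gradY_sub_le h.differentiable_g h.lip_g s.x s.x y y'
    rwa [pair_sub_pair, sub_self, norm_pair_zero_left] at h1
  · set y := innerY g β₀ ε s
    refine subLoopStops_of_lipschitz_gradient (L := ‖hessYY g s.x y‖)
      (φ := fun v => linSys f g s.x y v) (fun v => ?_) (fun v v' => ?_) ?_ hγ hε
    · rw [(h.gradLinSys_eq s.x y v).2]
      exact (h.gradLinSys_eq s.x y v).1
    · rw [(h.gradLinSys_eq s.x y v).2, (h.gradLinSys_eq s.x y v').2, sub_sub_sub_cancel_right,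
        ← map_sub]
      exact ContinuousLinearMap.le_opNorm _ _
    · refine ⟨-(‖-gradY f s.x y‖ ^ 2 / (2 * μ)), ?_⟩
      rintro _ ⟨v, rfl⟩
      refine (neg_le_inner_add_sq h.μ_pos (-gradY f s.x y) v).trans ?_
      have h1 := le_inner_hessYY h.contDiff_g (h.strongConvex s.x) y v
      rw [real_inner_comm] at h1
      simp only [linSys]
      rw [inner_neg_left, real_inner_comm]
      linarith

/-! ### The hypergradient -/

/-- Lipschitz bound for the hypergradient with the exact solution of the linear system. -/
lemma norm_hyperGrad_linSol_sub_le (h : Regular f g μ Lf1 Lg1 Lg2 Cfy Cgxy) (x x' : Vec dx)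
    (y y' : Vec dy) :
    ‖hyperGrad f g x y (linSol f g x y) - hyperGrad f g x' y' (linSol f g x' y')‖
      ≤ (Lf1 + Lg2 * Cfy / μ) * (1 + Cgxy / μ) * ‖pair x y - pair x' y'‖ := by
  have hμ := h.μ_pos
  have hC := h.Cgxy_nonneg
  have h1 : hyperGrad f g x y (linSol f g x y) - hyperGrad f g x' y' (linSol f g x' y')
      = (gradX f x y - gradX f x' y')
        - ((hessXY g x y - hessXY g x' y') (linSol f g x' y')
          + hessXY g x y (linSol f g x y - linSol f g x' y')) := by
    simp only [hyperGrad, _root_.sub_apply, map_sub]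
    abel
  rw [h1]
  set d := ‖pair x y - pair x' y'‖ with hd
  have hd0 : 0 ≤ d := norm_nonneg _
  have h2 : ‖gradX f x y - gradX f x' y'‖ ≤ Lf1 * d :=
    norm_gradX_sub_le h.differentiable_f h.lip_f x x' y y'
  have h3 : ‖(hessXY g x y - hessXY g x' y') (linSol f g x' y')‖ ≤ Lg2 * d * (Cfy / μ) :=
    (ContinuousLinearMap.le_opNorm _ _).trans (mul_le_mul (h.norm_hessXY_sub_le x x' y y')
      (h.norm_linSol_le x' y') (norm_nonneg _) (by positivity))
  have h4 : ‖hessXY g x y (linSol f g x y - linSol f g x' y')‖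
      ≤ Cgxy * (LbarV μ Lf1 Lg2 Cfy * d) :=
    (ContinuousLinearMap.le_opNorm _ _).trans (mul_le_mul (h.hessXY_le x y)
      (h.norm_linSol_sub_le x x' y y') (norm_nonneg _) hC)
  refine ((norm_sub_le _ _).trans (add_le_add h2 ((norm_add_le _ _).trans
    (add_le_add h3 h4)))).trans_eq ?_
  rw [LbarV]
  field_simp
  ring

lemma lowerSol_spec (h : Regular f g μ Lf1 Lg1 Lg2 Cfy Cgxy) (x : Vec dx) (y : Vec dy) :
    g (pair x (lowerSol g x)) ≤ g (pair x y) :=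
  Classical.epsilon_spec ((h.strongConvex x).exists_forall_le h.μ_pos
    (hasGradientAt_gradY h.differentiable_g x)) y

lemma gradY_lowerSol (h : Regular f g μ Lf1 Lg1 Lg2 Cfy Cgxy) (x : Vec dx) :
    gradY g x (lowerSol g x) = 0 := by
  have hmin : IsLocalMin (fun y => g (pair x y)) (lowerSol g x) :=
    Filter.Eventually.of_forall (h.lowerSol_spec x)
  have h1 := hmin.hasFDerivAt_eq_zero
    (hasGradientAt_gradY h.differentiable_g x (lowerSol g x)).hasFDerivAt
  exact (map_eq_zero_iff _ (InnerProductSpace.toDual ℝ (Vec dy)).injective).1 h1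

/-- A point with small `∇_y g` is close to the lower level solution. -/
lemma mul_norm_sub_lowerSol_le (h : Regular f g μ Lf1 Lg1 Lg2 Cfy Cgxy) (x : Vec dx)
    (y : Vec dy) : μ * ‖y - lowerSol g x‖ ≤ ‖gradY g x y‖ := by
  have h1 := (h.strongConvex x).mul_norm_sub_le (hasGradientAt_gradY h.differentiable_g x) y
    (lowerSol g x)
  rwa [h.gradY_lowerSol, sub_zero] at h1

/-- `C_{g_xy}` is a Lipschitz constant of `∇_y g(·, y)`. -/
lemma norm_gradY_sub_le_left (h : Regular f g μ Lf1 Lg1 Lg2 Cfy Cgxy) (x x' : Vec dx)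
    (y : Vec dy) : ‖gradY g x y - gradY g x' y‖ ≤ Cgxy * ‖x - x'‖ := by
  refine convex_univ.norm_image_sub_le_of_norm_hasFDerivWithin_le
    (fun z _ => (hasFDerivAt_gradY_left h.contDiff_g z y).hasFDerivWithinAt) (fun z _ => ?_)
    (Set.mem_univ x') (Set.mem_univ x)
  rw [LinearIsometryEquiv.norm_map]
  exact h.hessXY_le z y

lemma norm_lowerSol_sub_le (h : Regular f g μ Lf1 Lg1 Lg2 Cfy Cgxy) (x x' : Vec dx) :
    ‖lowerSol g x - lowerSol g x'‖ ≤ Cgxy / μ * ‖x - x'‖ := by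
  have h1 := h.mul_norm_sub_lowerSol_le x' (lowerSol g x)
  have h2 := h.norm_gradY_sub_le_left x' x (lowerSol g x)
  rw [h.gradY_lowerSol x, sub_zero, norm_sub_rev] at h2
  rw [div_mul_eq_mul_div, le_div_iff₀ h.μ_pos, mul_comm]
  exact h1.trans h2

lemma norm_pair_lowerSol_sub_le (h : Regular f g μ Lf1 Lg1 Lg2 Cfy Cgxy) (x x' : Vec dx) :
    ‖pair x (lowerSol g x) - pair x' (lowerSol g x')‖ ≤ (1 + Cgxy / μ) * ‖x - x'‖ := by
  rw [pair_sub_pair]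
  refine (norm_pair_le _ _).trans ?_
  linarith [h.norm_lowerSol_sub_le x x']

/-- The implicit function theorem for `∇_y g(x, y) = 0`. As the solution is already known to be
Lipschitz, it is enough to expand `0 = ∇_y g(x', y*(x')) - ∇_y g(x, y*(x))` to first order and to
apply the inverse of `∇_y ∇_y g`. -/
lemma hasFDerivAt_lowerSol (h : Regular f g μ Lf1 Lg1 Lg2 Cfy Cgxy) (x : Vec dx) :
    ∃ D : Vec dx →L[ℝ] Vec dy, HasFDerivAt (lowerSol g) D x ∧
      ∀ u, hessYY g x (lowerSol g x) (D u)
        = -ContinuousLinearMap.adjoint (hessXY g x (lowerSol g x)) u := by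
  set S := lowerSol g with hS
  set J := ContinuousLinearMap.adjoint (hessXY g x (S x)) with hJ
  obtain ⟨e, he⟩ := h.exists_equiv_hessYY x (S x)
  have he' : ∀ v, hessYY g x (S x) v = e v := fun v => by rw [← he]; rfl
  refine ⟨-((e.symm : Vec dy →L[ℝ] Vec dy) ∘L J), ?_, fun u => by simp [he']⟩
  have hbig : (fun x' => pair x' (S x') - pair x (S x)) =O[nhds x] fun x' => x' - x :=
    Asymptotics.IsBigO.of_bound (1 + Cgxy / μ)
      (Filter.Eventually.of_forall fun x' => h.norm_pair_lowerSol_sub_le x' x)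
  have htend : Filter.Tendsto (fun x' => pair x' (S x')) (nhds x) (nhds (pair x (S x))) := by
    refine tendsto_sub_nhds_zero_iff.1 (hbig.trans_tendsto ?_)
    exact tendsto_sub_nhds_zero_iff.2 Filter.tendsto_id
  have h1 := ((hasFDerivAt_gradY h.contDiff_g x (S x)).isLittleO.comp_tendsto htend).trans_isBigO
    hbig
  have h2 := ((e.symm : Vec dy →L[ℝ] Vec dy).isBigO_comp _ (nhds x)).trans_isLittleO h1
  refine HasFDerivAt.of_isLittleO (h2.neg_left.congr_left fun x' => ?_)
  have h3 : gradY g x' (S x') = 0 := h.gradY_lowerSol x'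
  have h4 : gradY g x (S x) = 0 := h.gradY_lowerSol x
  simp [h3, h4, he', ← hJ]
  abel

/-- The implicit gradient formula for `Φ`. -/
lemma hasGradientAt_Phi (h : Regular f g μ Lf1 Lg1 Lg2 Cfy Cgxy) (x : Vec dx) :
    HasGradientAt (Phi f g)
      (hyperGrad f g x (lowerSol g x) (linSol f g x (lowerSol g x))) x := by
  obtain ⟨D, hD, hHD⟩ := h.hasFDerivAt_lowerSol x
  set y := lowerSol g x with hy
  have h1 : HasFDerivAt (fun x' => pair x' (lowerSol g x'))
      ((WithLp.prodContinuousLinearEquiv 2 ℝ (Vec dx) (Vec dy)).symm.toContinuousLinearMap ∘L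
        (ContinuousLinearMap.id ℝ (Vec dx)).prod D) x :=
    (WithLp.prodContinuousLinearEquiv 2 ℝ (Vec dx) (Vec dy)).symm.hasFDerivAt.comp x
      ((hasFDerivAt_id x).prodMk hD)
  have h2 := (h.differentiable_f (pair x y)).hasGradientAt.hasFDerivAt.comp x h1
  rw [hasGradientAt_iff_hasFDerivAt]
  refine h2.congr_fderiv (ContinuousLinearMap.ext fun u => ?_)
  rw [ContinuousLinearMap.comp_apply, InnerProductSpace.toDual_apply_apply,
    InnerProductSpace.toDual_apply_apply]
  have h3 : ⟪gradY f x y, D u⟫_ℝ = -⟪hessXY g x y (linSol f g x y), u⟫_ℝ := by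
    rw [← h.hessYY_linSol x y, inner_hessYY_comm h.contDiff_g, hHD, inner_neg_right,
      ContinuousLinearMap.adjoint_inner_right]
  have h4 : ⟪∇ f (pair x y), pair u (D u)⟫_ℝ = ⟪gradX f x y, u⟫_ℝ + ⟪gradY f x y, D u⟫_ℝ := by
    rw [gradX_eq h.differentiable_f, gradY_eq h.differentiable_f]
    rfl
  rw [hyperGrad, inner_sub_left]
  exact h4.trans (by rw [h3]; ring)

lemma norm_gradient_Phi_sub_le (h : Regular f g μ Lf1 Lg1 Lg2 Cfy Cgxy) (x x' : Vec dx) :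
    ‖∇ (Phi f g) x - ∇ (Phi f g) x'‖ ≤ LPhi μ Lf1 Lg2 Cfy Cgxy * ‖x - x'‖ := by
  rw [(h.hasGradientAt_Phi x).gradient, (h.hasGradientAt_Phi x').gradient]
  refine (h.norm_hyperGrad_linSol_sub_le x x' _ _).trans ?_
  have hμ := h.μ_pos
  have := h.Cfy_nonneg
  have := h.Cgxy_nonneg
  rw [LPhi]
  calc _ ≤ (Lf1 + Lg2 * Cfy / μ) * (1 + Cgxy / μ) * ((1 + Cgxy / μ) * ‖x - x'‖) := by
        gcongr
        exact h.norm_pair_lowerSol_sub_le x x'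
    _ = _ := by ring

/-- The error of the hypergradient estimate, when both sub-problems are solved to accuracy `ε`.
The constant `L̄` comes from bounding the square of a sum of four terms: the changes of `∇_x f`,
of `∇_x ∇_y g` and of the solution of the linear system with `y`, and the error in `v`. -/
lemma norm_hyperGrad_sub_gradient_sq_le (h : Regular f g μ Lf1 Lg1 Lg2 Cfy Cgxy) {x : Vec dx}
    {y v : Vec dy} {ε : ℝ} (hy : ‖gradY g x y‖ ^ 2 ≤ ε) (hv : ‖gradLinSys f g x y v‖ ^ 2 ≤ ε) :
    ‖hyperGrad f g x y v - ∇ (Phi f g) x‖ ^ 2 ≤ 2 * Lbar μ Lf1 Lg2 Cfy Cgxy ^ 2 / μ ^ 2 * ε := by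
  have hμ := h.μ_pos
  have hC := h.Cgxy_nonneg
  have hCf := h.Cfy_nonneg
  rw [(h.hasGradientAt_Phi x).gradient]
  set y' := lowerSol g x
  set δ := ‖y - y'‖ with hδ
  set η := ‖v - linSol f g x y‖ with hη
  have hδε : δ ^ 2 ≤ ε / μ ^ 2 := by
    rw [le_div_iff₀ (by positivity), mul_comm, ← mul_pow]
    exact (pow_le_pow_left₀ (by positivity) (h.mul_norm_sub_lowerSol_le x y) 2).trans hy
  have hηε : η ^ 2 ≤ ε / μ ^ 2 := by
    rw [(h.gradLinSys_eq x y v).2, ← h.hessYY_linSol x y, ← map_sub] at hv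
    rw [le_div_iff₀ (by positivity), mul_comm, ← mul_pow]
    exact (pow_le_pow_left₀ (by positivity) (h.mul_norm_le_norm_hessYY x y _) 2).trans hv
  have hpair : ‖pair x y - pair x y'‖ = δ := by
    rw [pair_sub_pair, sub_self, norm_pair_zero_left]
  have h1 : hyperGrad f g x y v - hyperGrad f g x y' (linSol f g x y')
      = ((gradX f x y - gradX f x y') - (hessXY g x y - hessXY g x y') (linSol f g x y'))
        - (hessXY g x y (linSol f g x y - linSol f g x y')
          + hessXY g x y (v - linSol f g x y)) := by
    simp only [hyperGrad, _root_.sub_apply, map_sub]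
    abel
  set b : ℝ := Lg2 * (Cfy / μ) with hb
  set c : ℝ := Cgxy * LbarV μ Lf1 Lg2 Cfy with hc
  have h2 : ‖gradX f x y - gradX f x y'‖ ≤ Lf1 * δ := by
    rw [← hpair]
    exact norm_gradX_sub_le h.differentiable_f h.lip_f x x y y'
  have h3 : ‖(hessXY g x y - hessXY g x y') (linSol f g x y')‖ ≤ b * δ := by
    have h5 := h.norm_hessXY_sub_le x x y y'
    rw [hpair] at h5
    refine (ContinuousLinearMap.le_opNorm _ _).trans ((mul_le_mul h5
      (h.norm_linSol_le x y') (norm_nonneg _) (by positivity)).trans_eq ?_)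
    ring
  have h4 : ‖hessXY g x y (linSol f g x y - linSol f g x y')‖ ≤ c * δ := by
    have h5 := h.norm_linSol_sub_le x x y y'
    rw [hpair] at h5
    refine (ContinuousLinearMap.le_opNorm _ _).trans ((mul_le_mul (h.hessXY_le x y)
      h5 (norm_nonneg _) hC).trans_eq ?_)
    ring
  have h5 : ‖hessXY g x y (v - linSol f g x y)‖ ≤ Cgxy * η :=
    (ContinuousLinearMap.le_opNorm _ _).trans
      (mul_le_mul_of_nonneg_right (h.hessXY_le x y) (norm_nonneg _))
  have h6 : ‖hyperGrad f g x y v - hyperGrad f g x y' (linSol f g x y')‖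
      ≤ (Lf1 * δ + b * δ) + (c * δ + Cgxy * η) := by
    rw [h1]
    exact (norm_sub_le _ _).trans (add_le_add ((norm_sub_le _ _).trans (add_le_add h2 h3))
      ((norm_add_le _ _).trans (add_le_add h4 h5)))
  set Λ := Lbar μ Lf1 Lg2 Cfy Cgxy with hΛ
  have hΛ1 : 4 * ((Lf1 : ℝ) ^ 2 + b ^ 2 + c ^ 2) ≤ Λ ^ 2 := by
    have h7 : 2 * √(Cfy ^ 2 * Lg2 ^ 2 / μ ^ 2 + Lf1 ^ 2
        + Cgxy ^ 2 * LbarV μ Lf1 Lg2 Cfy ^ 2) ≤ Λ := le_max_left _ _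
    have h8 := pow_le_pow_left₀ (by positivity) h7 2
    rw [mul_pow, Real.sq_sqrt (by positivity)] at h8
    refine le_trans (le_of_eq ?_) h8
    rw [hb, hc]
    ring
  have hΛ2 : 4 * Cgxy ^ 2 ≤ Λ ^ 2 := by
    have h7 : 2 * Cgxy ≤ Λ := le_max_right _ _
    have h8 := pow_le_pow_left₀ (by positivity) h7 2
    rw [mul_pow] at h8
    linarith
  calc _ ≤ ((Lf1 * δ + b * δ) + (c * δ + Cgxy * η)) ^ 2 := pow_le_pow_left₀ (norm_nonneg _) h6 2
    _ ≤ 4 * ((Lf1 : ℝ) ^ 2 + b ^ 2 + c ^ 2) * δ ^ 2 + 4 * Cgxy ^ 2 * η ^ 2 := by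
        linarith [sq_nonneg (Lf1 * δ - b * δ), sq_nonneg (Lf1 * δ - c * δ),
          sq_nonneg (Lf1 * δ - Cgxy * η), sq_nonneg (b * δ - c * δ),
          sq_nonneg (b * δ - Cgxy * η), sq_nonneg (c * δ - Cgxy * η)]
    _ ≤ Λ ^ 2 * (ε / μ ^ 2) + Λ ^ 2 * (ε / μ ^ 2) := by gcongr
    _ = _ := by ring

end Regular

/-! ### The outer loop -/

section Outer

variable {dx dy : ℕ} {f g : Pair dx dy → ℝ}

/-- The direction of the outer step taken from the state `s`. -/
def outerDir (f g : Pair dx dy → ℝ) (β₀ γ₀ ε : ℝ) (s : State dx dy) : Vec dx :=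
  hyperGrad f g s.x (innerY g β₀ ε s) (innerV f g β₀ γ₀ ε ε s)

lemma outerStep_α_sq (β₀ γ₀ ε : ℝ) (s : State dx dy) :
    (outerStep f g β₀ γ₀ ε ε s).α ^ 2 = s.α ^ 2 + ‖outerDir f g β₀ γ₀ ε s‖ ^ 2 :=
  Real.sq_sqrt (by positivity)

lemma outerStep_x (β₀ γ₀ ε : ℝ) (s : State dx dy) :
    (outerStep f g β₀ γ₀ ε ε s).x
      = s.x - (1 / (outerStep f g β₀ γ₀ ε ε s).α) • outerDir f g β₀ γ₀ ε s := rfl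

lemma dtfbo_α_pos {x₀ : Vec dx} {y₀ v₀ : Vec dy} {α₀ β₀ γ₀ ε : ℝ} (hα : 0 < α₀) :
    ∀ t, 0 < (dtfbo f g x₀ y₀ v₀ α₀ β₀ γ₀ ε ε t).α
  | 0 => hα
  | t + 1 => Real.sqrt_pos.2 (by
      have := dtfbo_α_pos (x₀ := x₀) (y₀ := y₀) (v₀ := v₀) (β₀ := β₀) (γ₀ := γ₀) (ε := ε) hα t
      positivity)

variable {μ : ℝ} {Lf1 Lg1 Lg2 : ℝ≥0} {Cfy Cgxy : ℝ}

/-- The adaptive descent bound along the outer iterates. Solving both sub-problems to accuracy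
`1 / T` makes the errors of all `T` steps together contribute a constant. -/
lemma Regular.sum_norm_gradient_sq_le (h : Regular f g μ Lf1 Lg1 Lg2 Cfy Cgxy)
    (hinf : BddBelow (Set.range (Phi f g))) (x₀ : Vec dx) (y₀ v₀ : Vec dy) {α₀ β₀ γ₀ : ℝ}
    (hα : 0 < α₀) (hβ : 0 < β₀) (hγ : 0 < γ₀) {T : ℕ} (hT : 1 ≤ T) {c : ℝ}
    (hc : c = cOne μ Lf1 Lg1 Lg2 Cfy Cgxy α₀ (Phi f g x₀ - ⨅ x, Phi f g x)) :
    ∑ t ∈ Finset.range T,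
        ‖∇ (Phi f g) (dtfbo f g x₀ y₀ v₀ α₀ β₀ γ₀ (1 / (T : ℝ)) (1 / (T : ℝ)) t).x‖ ^ 2
      ≤ c * (Calpha μ Lf1 Lg2 Cfy Cgxy α₀ + 2 * c) := by
  have hT' : (0 : ℝ) < T := by exact_mod_cast hT
  set ε : ℝ := 1 / (T : ℝ) with hε
  have hε0 : 0 < ε := by positivity
  have hμ := h.μ_pos
  have hC := h.Cgxy_nonneg
  have hCf := h.Cfy_nonneg
  set s : ℕ → State dx dy := dtfbo f g x₀ y₀ v₀ α₀ β₀ γ₀ ε ε with hs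
  set d : ℕ → Vec dx := fun t => outerDir f g β₀ γ₀ ε (s t) with hd
  set L := LPhi μ Lf1 Lg2 Cfy Cgxy with hLdef
  have hL : 0 ≤ L := by rw [hLdef, LPhi]; positivity
  set e : ℝ := 2 * Lbar μ Lf1 Lg2 Cfy Cgxy ^ 2 / μ ^ 2 * ε with he
  have hgrad : ∀ x, HasGradientAt (Phi f g) (∇ (Phi f g) x) x := fun x =>
    (h.hasGradientAt_Phi x).differentiableAt.hasGradientAt
  have hpos : ∀ t, 0 < (s t).α := dtfbo_α_pos hα
  refine sum_le_of_adaptive_descent (a := fun t => (s t).α) (φ := fun t => Phi f g (s t).x)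
    (H := fun t => ‖d t‖ ^ 2) (L := L) (e := e)
    (C := Calpha μ Lf1 Lg2 Cfy Cgxy α₀) (m := ⨅ x, Phi f g x)
    hα hpos (fun t => outerStep_α_sq β₀ γ₀ ε (s t)) (fun t => by positivity)
    (fun t => by positivity) hL (by positivity) (le_max_left _ _) (le_max_right _ _)
    (fun t _ => ?_) (ciInf_le hinf _) ?_
  · have hterm := h.loopsStop hβ hγ hε0 (s t)
    have herr : ‖d t - ∇ (Phi f g) (s t).x‖ ^ 2 ≤ e :=
      h.norm_hyperGrad_sub_gradient_sq_le hterm.1.norm_sq_le hterm.2.norm_sq_le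
    have hstep := step_le_of_lipschitz_gradient hgrad h.norm_gradient_Phi_sub_le (s t).x (d t)
      (s (t + 1)).α
    have hx : (s (t + 1)).x = (s t).x - (1 / (s (t + 1)).α) • d t := outerStep_x β₀ γ₀ ε (s t)
    rw [← hx] at hstep
    refine hstep.trans (add_le_add_left (sub_le_sub_left ?_ _) _)
    -- polarization: `2 ⟪∇Φ, d⟫ = ‖∇Φ‖² + ‖d‖² - ‖d - ∇Φ‖²`
    have hp := hpos (t + 1)
    rw [div_le_div_iff₀ (by positivity) hp]
    rw [norm_sub_sq_real, real_inner_comm] at herr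
    nlinarith [mul_nonneg hp.le (sub_nonneg.2 herr)]
  · have h1 : (T : ℝ) * (e / α₀) = 1 / α₀ * (2 * Lbar μ Lf1 Lg2 Cfy Cgxy ^ 2 / μ ^ 2) := by
      rw [he, hε]
      field_simp
    -- the part of `c₁ - c₀` that the estimate does not need
    have h2 : 0 ≤ 1 / α₀ * ((2 / μ ^ 2 * (Lg2 * Cfy / μ + Lf1) + 1) * Lg1 ^ 2
        * Lbar μ Lf1 Lg2 Cfy Cgxy ^ 2) := by positivity
    have h3 : (s 0).α = α₀ := rfl
    have h4 : (s 0).x = x₀ := rfl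
    simp only [h3, h4, h1, hc, cOne, cZero, ← hLdef]
    rw [mul_add (1 / α₀)]
    linarith

end Outer

end Bilevel

end

theorem mainTheorem1 {dx dy : ℕ} (f g : Bilevel.Pair dx dy → ℝ)
    (μ : ℝ) (Lf0 Lf1 Lg1 Lg2 : ℝ≥0) (Cfy Cgxy : ℝ)
    (hμ : 0 < μ)
    (hf : ContDiff ℝ 2 f) (hg : ContDiff ℝ 2 g)
    (hsc : ∀ x : Bilevel.Vec dx, StrongConvexOn Set.univ μ (fun y => g (Bilevel.pair x y)))
    (hLf0 : LipschitzWith Lf0 f)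
    (hLf1 : LipschitzWith Lf1 (gradient f))
    (hLg1 : LipschitzWith Lg1 (gradient g))
    (hLgxy : LipschitzWith Lg2 (fun z : Bilevel.Pair dx dy => Bilevel.hessXY g z.fst z.snd))
    (hLgyy : LipschitzWith Lg2 (fun z : Bilevel.Pair dx dy => Bilevel.hessYY g z.fst z.snd))
    (hCfy : ∀ x y, ‖Bilevel.gradY f x y‖ ≤ Cfy)
    (hCgxy : ∀ x y, ‖Bilevel.hessXY g x y‖ ≤ Cgxy)
    (hinf : BddBelow (Set.range (Bilevel.Phi f g)))
    (x₀ : Bilevel.Vec dx) (y₀ v₀ : Bilevel.Vec dy)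
    (α₀ β₀ γ₀ : ℝ) (hα₀ : 0 < α₀) (hβ₀ : 0 < β₀) (hγ₀ : 0 < γ₀) :
    let Φ := Bilevel.Phi f g
    let run : ℕ → ℕ → Bilevel.State dx dy := fun T =>
      Bilevel.dtfbo f g x₀ y₀ v₀ α₀ β₀ γ₀ (1 / (T : ℝ)) (1 / (T : ℝ))
    let Cα := Bilevel.Calpha μ Lf1 Lg2 Cfy Cgxy α₀
    let c₁ := Bilevel.cOne μ Lf1 Lg1 Lg2 Cfy Cgxy α₀ (Φ x₀ - ⨅ x, Φ x)
    Differentiable ℝ Φ ∧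
    (∀ T : ℕ, 1 ≤ T →
      (∀ t < T, Bilevel.LoopsStop f g β₀ γ₀ (1 / (T : ℝ)) (1 / (T : ℝ)) (run T t)) ∧
      1 / (T : ℝ) * ∑ t ∈ Finset.range T, ‖gradient Φ (run T t).x‖ ^ 2 ≤
        c₁ * (Cα + 2 * c₁) / (T : ℝ)) ∧
    (fun T : ℕ => 1 / (T : ℝ) * ∑ t ∈ Finset.range T, ‖gradient Φ (run T t).x‖ ^ 2)
      =O[Filter.atTop] (fun T : ℕ => 1 / (T : ℝ)) := by
  have h : Bilevel.Regular f g μ Lf1 Lg1 Lg2 Cfy Cgxy :=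
    ⟨hμ, hf, hg, hsc, hLf1, hLg1, hLgxy, hLgyy, hCfy, hCgxy⟩
  intro Φ run Cα c₁
  have hbound : ∀ T : ℕ, 1 ≤ T →
      1 / (T : ℝ) * ∑ t ∈ Finset.range T, ‖gradient Φ (run T t).x‖ ^ 2
        ≤ c₁ * (Cα + 2 * c₁) / (T : ℝ) := fun T hT => by
    rw [one_div_mul_eq_div]
    gcongr
    exact h.sum_norm_gradient_sq_le hinf x₀ y₀ v₀ hα₀ hβ₀ hγ₀ hT rfl
  refine ⟨fun x => (h.hasGradientAt_Phi x).differentiableAt,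
    fun T hT => ⟨fun t _ => ?_, hbound T hT⟩,
    Asymptotics.IsBigO.of_bound (c₁ * (Cα + 2 * c₁)) ?_⟩
  · have hT' : (0 : ℝ) < T := by exact_mod_cast hT
    exact h.loopsStop hβ₀ hγ₀ (one_div_pos.2 hT') _
  · filter_upwards [Filter.eventually_ge_atTop 1] with T hT
    rw [Real.norm_of_nonneg (by positivity), Real.norm_of_nonneg (by positivity),
      mul_one_div]
    exact hbound T hT
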